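/- Conventions. A hyperbolic space is a geodesic metric space $X$ that is Gromov hyperbolic, i.e. for some $\delta\ge 0$ and all $w,x,y,z\in X$, $(x\mid z)_w\ge\min\{(x\mid y)_w,(y\mid z)_w\}-\delta$, where $(x\mid y)_w=\frac12(d(w,x)+d(w,y)-d(x,y))$. Its boundary $\partial X$ is the set of sequences $(x_n)$ in $X$ with $(x_m\mid x_n)_w\to\infty$ as $m,n\to\infty$, modulo $(x_n)\sim(y_n)$ iff $(x_n\mid y_n)_w\to\infty$ (this does not depend on $w$). A map $f\colon A\to X$ from a metric space is a quasi-isometric embedding if there is $\tau\ge1$ with $\tau^{-1}d(a,b)-\tau\le d(f(a),f(b))\le\tau d(a,b)+\tau$ for all $a,b\in A$. Let a group $G$ act by isometries on a hyperbolic space $X$. - An element $g\in G$ is loxodromic if for some $x\in X$ the map $n\mapsto g^nx$ is a quasi-isometric embedding $\mathbb Z\to X$. A loxodromic element $g$ is WPD if for all $x\in X$ and $\varepsilon\ge 0$ there is an integer $N>0$ such that $\{\gamma\in G: d(x,\gamma x)\le\varepsilon,\ d(g^Nx,\gamma g^Nx)\le\varepsilon\}$ is finite. Loxodromic elements $h_1,\dots,h_k$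 are independent if for $i\ne j$ no point of $\partial X$ is fixed by both $h_i$ and $h_j$. - $(G,X,H)$ is an A/QI triple if $H\le G$ is a finitely generated infinite subgroup such that (a) for some $x\in X$ the action is acylindrical along $Y=Hx$, meaning that for every $\varepsilon\ge0$ there are $R,M>0$ such that $\#\{g\in G: d(gy,y)\le\varepsilon,\ d(gz,z)\le\varepsilon\}\le M$ for all $y,z\in Y$ with $d(y,z)\ge R$; and (b) for $x\in X$ the orbit map $H\to X$, $a\mapsto ax$, is a quasi-isometric embedding, where $H$ carries the word metric of a finite generating set. Corollary 4.5. Let $G$ act by isometries on a hyperbolic space $X$, let $k\ge1$, and let $h_1,\dots,h_k\in G$ be independent loxodromic WPD elements for this action. Then there is an integer $D\ge1$ such that for all integers $d_1,\dots,d_k\ge D$, the subgroup $H=\langle h_1^{d_1},\dots,h_k^{d_k}\rangle$ gives an A/QI triple $(G,X,H)$, and every nontrivial element of $H$ is a loxodromic WPD element for the action of $G$ on $X$. -/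

import Mathlib

open Filter

namespace AQI

/-! ### Hyperbolic spaces and their boundary -/

/-- The Gromov product `(x | y)_w`. -/
noncomputable def gromovProduct {X : Type*} [MetricSpace X] (w x y : X) : ℝ :=
  (dist w x + dist w y - dist x y) / 2

/-- A hyperbolic space: a geodesic metric space which is Gromov hyperbolic, i.e. satisfies the
four-point inequality `(x | z)_w ≥ min ((x | y)_w) ((y | z)_w) - δ` for some `δ`. -/
class HyperbolicSpace (X : Type*) [MetricSpace X] : Prop where
  exists_geodesic : ∀ x y : X, ∃ γ : ℝ → X, γ 0 = x ∧ γ (dist x y) = y ∧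
    ∀ s ∈ Set.Icc 0 (dist x y), ∀ t ∈ Set.Icc 0 (dist x y), dist (γ s) (γ t) = |s - t|
  exists_delta : ∃ δ : ℝ, 0 ≤ δ ∧ ∀ w x y z : X,
    min (gromovProduct w x y) (gromovProduct w y z) - δ ≤ gromovProduct w x z

/-- The sequence `u` converges to infinity: `(u m | u n)_w → ∞` as `m, n → ∞`. This does not
depend on the base point `w`; all base points are quantified over. -/
def ConvergesToInfinity {X : Type*} [MetricSpace X] (u : ℕ → X) : Prop :=
  ∀ w : X, Tendsto (fun p : ℕ × ℕ => gromovProduct w (u p.1) (u p.2)) atTop atTop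

/-- Sequences in `X` which converge to infinity. -/
def SeqToInfinity (X : Type*) [MetricSpace X] : Type _ :=
  {u : ℕ → X // ConvergesToInfinity u}

/-- Two sequences converging to infinity are equivalent when `(u n | v n)_w → ∞`. -/
instance boundarySetoid (X : Type*) [MetricSpace X] [HyperbolicSpace X] :
    Setoid (SeqToInfinity X) where
  r u v := ∀ w : X, Tendsto (fun n : ℕ => gromovProduct w (u.1 n) (v.1 n)) atTop atTop
  iseqv :=
    { refl := fun u w => (u.2 w).comp
        (tendsto_atTop_atTop.2 fun b => ⟨max b.1 b.2, fun n hn =>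
          ⟨(le_max_left _ _).trans hn, (le_max_right _ _).trans hn⟩⟩ :
          Tendsto (fun n : ℕ => (n, n)) atTop atTop)
      symm := fun {u v} h w => (h w).congr fun n => by
        simp only [gromovProduct, dist_comm (u.1 n) (v.1 n)]; ring
      trans := fun {u v t} h₁ h₂ w => by
        obtain ⟨δ, -, hδ⟩ := HyperbolicSpace.exists_delta (X := X)
        refine tendsto_atTop.2 fun b => ?_
        filter_upwards [tendsto_atTop.1 (h₁ w) (b + δ), tendsto_atTop.1 (h₂ w) (b + δ)]
          with n hn₁ hn₂
        have h₃ := hδ w (u.1 n) (v.1 n) (t.1 n)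
        have h₄ := le_min hn₁ hn₂
        linarith }

/-- The Gromov boundary: classes of sequences converging to infinity. -/
def Boundary (X : Type*) [MetricSpace X] [HyperbolicSpace X] : Type _ :=
  Quotient (boundarySetoid X)

theorem gromovProduct_smul {G X : Type*} [Group G] [MetricSpace X] [MulAction G X]
    [IsIsometricSMul G X] (g : G) (w x y : X) :
    gromovProduct w (g • x) (g • y) = gromovProduct (g⁻¹ • w) x y := by
  have h : ∀ z : X, dist w (g • z) = dist (g⁻¹ • w) z := fun z => by
    rw [← dist_smul g (g⁻¹ • w) z, smul_inv_smul]
  simp only [gromovProduct, h, dist_smul]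

/-- Isometries act on the boundary by acting on sequences term by term. -/
instance boundaryAction (G X : Type*) [Group G] [MetricSpace X] [HyperbolicSpace X]
    [MulAction G X] [IsIsometricSMul G X] : MulAction G (Boundary X) where
  smul g := Quotient.map
    (fun u : SeqToInfinity X => (⟨fun n => g • u.1 n, fun w => by
      simpa only [gromovProduct_smul] using u.2 (g⁻¹ • w)⟩ : SeqToInfinity X))
    (fun u v h w => by
      simpa only [gromovProduct_smul] using h (g⁻¹ • w))
  one_smul ξ := by
    refine Quotient.inductionOn ξ fun u => ?_
    exact congrArg (Quotient.mk _) (Subtype.ext (funext fun n => one_smul G (u.1 n)))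
  mul_smul g h ξ := by
    refine Quotient.inductionOn ξ fun u => ?_
    exact congrArg (Quotient.mk _) (Subtype.ext (funext fun n => mul_smul g h (u.1 n)))

/-! ### Loxodromic and WPD elements -/

/-- `f` is a `τ`-quasi-isometric embedding into `X`, where `dA` is the metric on the source. -/
def IsQIEmbedding {A X : Type*} [MetricSpace X] (τ : ℝ) (dA : A → A → ℝ) (f : A → X) : Prop :=
  ∀ a b : A, τ⁻¹ * dA a b - τ ≤ dist (f a) (f b) ∧ dist (f a) (f b) ≤ τ * dA a b + τ

/-- `g` acts loxodromically: `n ↦ gⁿ x` is a quasi-isometric embedding of `ℤ` for some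
(equivalently every) point `x`. -/
def IsLoxodromic {G : Type*} (X : Type*) [Group G] [MetricSpace X] [MulAction G X]
    (g : G) : Prop :=
  ∃ x : X, ∃ τ : ℝ, 1 ≤ τ ∧
    IsQIEmbedding τ (fun m n : ℤ => |(m : ℝ) - (n : ℝ)|) (fun n : ℤ => g ^ n • x)

/-- `g` is a loxodromic WPD element of `G` with respect to the action on `X`. -/
def IsLoxodromicWPD {G : Type*} (X : Type*) [Group G] [MetricSpace X] [MulAction G X]
    (g : G) : Prop :=
  IsLoxodromic X g ∧ ∀ x : X, ∀ ε : ℝ, 0 ≤ ε → ∃ N : ℕ, 0 < N ∧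
    {γ : G | dist x (γ • x) ≤ ε ∧ dist (g ^ N • x) (γ • g ^ N • x) ≤ ε}.Finite

/-- The elements `h i` are independent: the sets of points of the boundary fixed by `h i` and by
`h j` are disjoint whenever `i ≠ j`. -/
def Independent {G : Type*} (X : Type*) [Group G] [MetricSpace X] [HyperbolicSpace X]
    [MulAction G X] [IsIsometricSMul G X] {ι : Type*} (h : ι → G) : Prop :=
  ∀ i j : ι, i ≠ j →
    Disjoint (MulAction.fixedBy (Boundary X) (h i)) (MulAction.fixedBy (Boundary X) (h j))

/-! ### A/QI triples -/

/-- The length of a shortest word in `T ∪ T⁻¹` representing `g` (for a generating set `T`). -/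
noncomputable def wordLength {H : Type*} [Group H] (T : Set H) (g : H) : ℕ :=
  sInf {n : ℕ | ∃ l : List H, l.length = n ∧ (∀ s ∈ l, s ∈ T ∨ s⁻¹ ∈ T) ∧ l.prod = g}

/-- The action is acylindrical along the subset `Y`. -/
def AcylindricalAlong (G : Type*) {X : Type*} [Group G] [MetricSpace X] [MulAction G X]
    (Y : Set X) : Prop :=
  ∀ ε : ℝ, 0 ≤ ε → ∃ R : ℝ, 0 < R ∧ ∃ M : ℕ, 0 < M ∧ ∀ x ∈ Y, ∀ y ∈ Y, R ≤ dist x y →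
    {g : G | dist (g • x) x ≤ ε ∧ dist (g • y) y ≤ ε}.encard ≤ (M : ℕ∞)

/-- `H` is finitely generated and its orbit maps into `X` are quasi-isometric embeddings, where
`H` carries the word metric of a finite generating set (the choice is immaterial, since any two
such word metrics are bi-Lipschitz equivalent). -/
def QIEmbeddedByAction {G : Type*} (X : Type*) [Group G] [MetricSpace X] [MulAction G X]
    (H : Subgroup G) : Prop :=
  ∃ T : Set H, T.Finite ∧ Subgroup.closure T = ⊤ ∧ ∀ x : X, ∃ τ : ℝ, 1 ≤ τ ∧
    IsQIEmbedding τ (fun a b : H => (wordLength T (a⁻¹ * b) : ℝ)) (fun a : H => (a : G) • x)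

/-- `(G, X, H)` is an A/QI triple. -/
structure IsAQITriple (G X : Type*) [Group G] [MetricSpace X] [HyperbolicSpace X]
    [MulAction G X] [IsIsometricSMul G X] (H : Subgroup G) : Prop where
  fg : H.FG
  infinite : Infinite H
  acylindrical : ∃ x : X, AcylindricalAlong G (Set.range fun a : H => (a : G) • x)
  qi : QIEmbeddedByAction X H

end AQI

/-!
Only the four-point inequality is used, never geodesics or stability of quasi-geodesics. Its main
consequence is the local-to-global principle for broken geodesics: if consecutive points
`x_0, ..., x_n` are at distance at least `L`, the turns `(x_{i-1} | x_{i+1})_{x_i}` are at most `C`,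
and `L > 2C + 3δ`, then `d(x_0, x_n)` grows linearly in `n` and every `x_i` stays near a geodesic
from `x_0` to `x_n` (`FourPoint.gromovProduct_vertex_le`, `FourPoint.le_dist_start_end`).

For a loxodromic `h` this applies to the orbit of a suitable power, so the products
`(h⁻ᵐ p | hⁿ p)_p` are bounded and the orbit converges to a boundary point fixed by `h`. Hence for
independent elements the products of points on different half-orbits are bounded too, and there is
a single bound `C` on the turns of the path of any reduced word in the `h_i ^ d_i`, whatever the
exponents (`Independent.exists_turn_le`). Once the exponents are so large that each generator
displaces `p` by `2C + 3δ + 1`, the displacement of `p` by a reduced word is at least its length.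
The group is then free on these generators, its orbit maps are quasi-isometric embeddings, and its
nontrivial elements are loxodromic because the length of `wⁿ` is at least `n`.

For acylindricity (`IsSpread.acylindricalAlong`), let `g` move both ends of the path of a long
reduced word by at most `ε`, and let `q`, `q'` be consecutive vertices far from the ends. Then `g`
essentially shifts `q` and `q'` along the path by at most `ε`, and two such `g` with nearly the same
shifts differ by an isometry moving `q` and `q'` by at most `2C + 10δ + 1`, a constant independent
of `ε` and of the exponents. As `q` and `q'` differ by one generator, the WPD condition for `h_i`
leaves only finitely many such isometries when `d_i` is large, with a bound uniform over the
finitely many generators. Acylindricity along the orbit in turn makes every loxodromic element of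
the group WPD.
-/

open Filter

namespace AQI

/-! ### Gromov products and the four-point inequality -/

section Metric

variable {X : Type*} [MetricSpace X]

theorem gromovProduct_comm (w x y : X) : gromovProduct w x y = gromovProduct w y x := by
  simp only [gromovProduct, dist_comm x y]; ring

theorem gromovProduct_nonneg (w x y : X) : 0 ≤ gromovProduct w x y := by
  have := dist_triangle_left x y w
  unfold gromovProduct; linarith

theorem gromovProduct_le_dist_left (w x y : X) : gromovProduct w x y ≤ dist w x := by
  have := dist_triangle w x y
  unfold gromovProduct; linarith

theorem gromovProduct_le_dist_right (w x y : X) : gromovProduct w x y ≤ dist w y := by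
  rw [gromovProduct_comm]; exact gromovProduct_le_dist_left w y x

theorem gromovProduct_self_left (x y : X) : gromovProduct x x y = 0 := by
  simp [gromovProduct]

theorem gromovProduct_add_swap (w x y : X) :
    gromovProduct w x y + gromovProduct x w y = dist w x := by
  simp only [gromovProduct, dist_comm x w]; ring

theorem gromovProduct_le_add_dist_base (w w' x y : X) :
    gromovProduct w x y ≤ gromovProduct w' x y + dist w w' := by
  have h₁ := dist_triangle w w' x
  have h₂ := dist_triangle w w' y
  unfold gromovProduct; linarith

theorem gromovProduct_le_add_dist_left (w x x' y : X) :
    gromovProduct w x y ≤ gromovProduct w x' y + dist x x' := by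
  have h₁ := dist_triangle_right w x x'
  have h₂ := dist_triangle_left x' y x
  unfold gromovProduct; linarith

theorem gromovProduct_le_add_dist_right (w x y y' : X) :
    gromovProduct w x y ≤ gromovProduct w x y' + dist y y' := by
  simpa only [gromovProduct_comm w x] using gromovProduct_le_add_dist_left w y y' x

theorem gromovProduct_smul_smul {G : Type*} [Group G] [MulAction G X] [IsIsometricSMul G X]
    (g : G) (w x y : X) :
    gromovProduct (g • w) (g • x) (g • y) = gromovProduct w x y := by
  simp only [gromovProduct, dist_smul]

/-- The four-point inequality with constant `δ`. -/
def FourPoint (X : Type*) [MetricSpace X] (δ : ℝ) : Prop :=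
  ∀ w x y z : X, min (gromovProduct w x y) (gromovProduct w y z) - δ ≤ gromovProduct w x z

variable {δ : ℝ}

/-- The four-point inequality in terms of the three sums of opposite distances. -/
theorem FourPoint.dist_add_dist_le (hX : FourPoint X δ) (a b u v : X) :
    dist u v + dist a b ≤ max (dist u a + dist v b) (dist u b + dist v a) + 2 * δ := by
  have h := hX u a v b
  simp only [gromovProduct, dist_comm a v] at h
  rcases min_choice ((dist u a + dist u v - dist v a) / 2) ((dist u v + dist u b - dist v b) / 2)
    with h' | h' <;> rw [h'] at h
  · linarith [le_max_right (dist u a + dist v b) (dist u b + dist v a)]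
  · linarith [le_max_left (dist u a + dist v b) (dist u b + dist v a)]

/-- The form in which the four-point inequality is applied: if `(x | z)_w ≤ c` but `(x | y)_w` is
larger than `c + δ`, then the minimum in the inequality is attained by `(y | z)_w`. -/
theorem FourPoint.le_of_lt (hX : FourPoint X δ) {w x y z : X} {c : ℝ}
    (h : gromovProduct w x z ≤ c) (hxy : c + δ < gromovProduct w x y) :
    gromovProduct w y z ≤ c + δ := by
  by_contra! h'
  have := hX w x y z
  have := lt_min hxy h'
  linarith

/-! ### Broken geodesics -/

/-- The initial segments of a broken geodesic do not backtrack. -/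
theorem FourPoint.gromovProduct_start_le (hX : FourPoint X δ) (hδ : 0 ≤ δ) {C L : ℝ} (hC : 0 ≤ C)
    (hL : 2 * C + 3 * δ < L) {x : ℕ → X} {n : ℕ} (hd : ∀ i < n, L ≤ dist (x i) (x (i + 1)))
    (ht : ∀ i, i + 1 < n → gromovProduct (x (i + 1)) (x i) (x (i + 2)) ≤ C) :
    ∀ i < n, gromovProduct (x i) (x 0) (x (i + 1)) ≤ C + δ := by
  intro i
  induction i with
  | zero => intro _; rw [gromovProduct_self_left]; positivity
  | succ i ih =>
    intro hi
    have h₁ := ih (by omega)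
    have h₂ := gromovProduct_add_swap (x i) (x (i + 1)) (x 0)
    rw [gromovProduct_comm (x i)] at h₂
    refine hX.le_of_lt (ht i hi) ?_
    linarith [hd i (by omega)]

/-- The final segments of a broken geodesic do not backtrack: reverse the path. -/
theorem FourPoint.gromovProduct_end_le (hX : FourPoint X δ) (hδ : 0 ≤ δ) {C L : ℝ} (hC : 0 ≤ C)
    (hL : 2 * C + 3 * δ < L) {x : ℕ → X} {n : ℕ} (hd : ∀ i < n, L ≤ dist (x i) (x (i + 1)))
    (ht : ∀ i, i + 1 < n → gromovProduct (x (i + 1)) (x i) (x (i + 2)) ≤ C) {i : ℕ} (hi : i < n) :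
    gromovProduct (x (i + 1)) (x i) (x n) ≤ C + δ := by
  have h := hX.gromovProduct_start_le hδ hC hL (x := fun j => x (n - j)) (n := n)
    (fun j hj => by
      have := hd (n - (j + 1)) (by omega)
      rwa [show n - (j + 1) + 1 = n - j by omega, dist_comm] at this)
    (fun j hj => by
      have := ht (n - (j + 2)) (by omega)
      rwa [show n - (j + 2) + 1 = n - (j + 1) by omega, show n - (j + 2) + 2 = n - j by omega,
        gromovProduct_comm] at this)
    (n - (i + 1)) (by omega)
  simpa only [show n - (n - (i + 1)) = i + 1 by omega, show n - (n - (i + 1) + 1) = i by omega,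
    Nat.sub_zero, gromovProduct_comm (x (i + 1)) (x n)] using h

/-- The vertices of a broken geodesic stay close to any geodesic joining its ends. -/
theorem FourPoint.gromovProduct_vertex_le (hX : FourPoint X δ) (hδ : 0 ≤ δ) {C L : ℝ} (hC : 0 ≤ C)
    (hL : 2 * C + 3 * δ < L) {x : ℕ → X} {n : ℕ} (hd : ∀ i < n, L ≤ dist (x i) (x (i + 1)))
    (ht : ∀ i, i + 1 < n → gromovProduct (x (i + 1)) (x i) (x (i + 2)) ≤ C) {i : ℕ} (hi : i ≤ n) :
    gromovProduct (x i) (x 0) (x n) ≤ C + 2 * δ := by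
  rcases hi.lt_or_eq with hi | rfl
  · have h₁ := hX.gromovProduct_start_le hδ hC hL hd ht i hi
    have h₂ := hX.gromovProduct_end_le hδ hC hL hd ht hi
    have h₃ := gromovProduct_add_swap (x i) (x (i + 1)) (x n)
    rw [gromovProduct_comm] at h₁ ⊢
    have := hX (x i) (x (i + 1)) (x n) (x 0)
    by_contra! h₄
    have := lt_min (show C + 2 * δ < gromovProduct (x i) (x (i + 1)) (x n) by
      linarith [hd i hi]) h₄
    linarith
  · rw [gromovProduct_comm, gromovProduct_self_left]; positivity

/-- The distance between the ends of a broken geodesic grows linearly with the number of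
segments. -/
theorem FourPoint.le_dist_start_end (hX : FourPoint X δ) (hδ : 0 ≤ δ) {C L : ℝ} (hC : 0 ≤ C)
    (hL : 2 * C + 3 * δ < L) {x : ℕ → X} {n : ℕ} (hd : ∀ i < n, L ≤ dist (x i) (x (i + 1)))
    (ht : ∀ i, i + 1 < n → gromovProduct (x (i + 1)) (x i) (x (i + 2)) ≤ C) :
    n * (L - 2 * C - 2 * δ) ≤ dist (x 0) (x n) := by
  have key : ∀ i ≤ n, i * (L - 2 * C - 2 * δ) ≤ dist (x 0) (x i) := by
    intro i
    induction i with
    | zero => simp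
    | succ i ih =>
      intro hi
      have h₁ := hX.gromovProduct_start_le hδ hC hL hd ht i hi
      have h₂ := ih (by omega)
      have h₃ := hd i hi
      simp only [gromovProduct, dist_comm (x i) (x 0)] at h₁
      push_cast
      linarith
  exact key n le_rfl

end Metric

/-! ### Orbits of loxodromic elements -/

section Orbit

variable {G X : Type*} [Group G] [MetricSpace X] [MulAction G X] [IsIsometricSMul G X] {δ : ℝ}

theorem dist_smul_smul_mul (a b : G) (p : X) : dist (a • p) (b • p) = dist p ((a⁻¹ * b) • p) := by
  rw [← dist_smul a p, smul_smul, mul_inv_cancel_left]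

theorem dist_inv_smul_self (a : G) (p : X) : dist p (a⁻¹ • p) = dist p (a • p) := by
  rw [← dist_smul a p, smul_inv_smul, dist_comm]

theorem dist_pow_smul_le (h : G) (p : X) (n : ℕ) : dist p (h ^ n • p) ≤ n * dist p (h • p) := by
  induction n with
  | zero => simp
  | succ n ih =>
    have := dist_triangle p (h ^ n • p) (h ^ (n + 1) • p)
    rw [pow_succ, mul_smul, dist_smul, ← mul_smul, ← pow_succ] at this
    push_cast
    linarith

/-- At every base point the displacement of the powers of a loxodromic element grows linearly. -/
theorem IsLoxodromic.exists_le_dist_pow {h : G} (hh : IsLoxodromic X h) (p : X) :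
    ∃ τ : ℝ, 1 ≤ τ ∧ ∀ n : ℕ, τ⁻¹ * n - τ ≤ dist p (h ^ n • p) := by
  obtain ⟨x, τ, hτ, H⟩ := hh
  refine ⟨τ + 2 * dist p x, by linarith [dist_nonneg (x := p) (y := x)], fun n => ?_⟩
  have h₁ := (H 0 n).1
  simp only [zpow_zero, one_smul, zpow_natCast, Int.cast_zero, zero_sub, abs_neg, Int.cast_natCast,
    Nat.abs_cast] at h₁
  have h₂ := dist_triangle x p (h ^ n • x)
  have h₃ := dist_triangle p (h ^ n • p) (h ^ n • x)
  rw [dist_smul] at h₃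
  have h₄ : (τ + 2 * dist p x)⁻¹ * n ≤ τ⁻¹ * n := by
    gcongr
    linarith [dist_nonneg (x := p) (y := x)]
  rw [dist_comm x p] at h₂
  linarith

theorem IsLoxodromic.tendsto_dist_pow {h : G} (hh : IsLoxodromic X h) (p : X) :
    Tendsto (fun n : ℕ => dist p (h ^ n • p)) atTop atTop := by
  obtain ⟨τ, hτ, H⟩ := hh.exists_le_dist_pow p
  refine tendsto_atTop_mono H (tendsto_atTop_add_const_right _ _ ?_)
  exact tendsto_natCast_atTop_atTop.const_mul_atTop (by positivity)

/-- Some power `h ^ N` of a loxodromic element turns little at `p` compared with its displacement: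
otherwise the displacement of `h ^ 2 ^ k` would grow at most linearly with `k`. -/
theorem IsLoxodromic.exists_dist_pow_add_lt {h : G} (hh : IsLoxodromic X h) (p : X) (c : ℝ) :
    ∃ N : ℕ, 0 < N ∧ dist p (h ^ N • p) + c < dist p (h ^ (2 * N) • p) := by
  obtain ⟨τ, hτ, H⟩ := hh.exists_le_dist_pow p
  by_contra! hcon
  have key : ∀ k : ℕ, dist p (h ^ 2 ^ k • p) ≤ dist p (h • p) + k * c := by
    intro k
    induction k with
    | zero => simp
    | succ k ih =>
      have := hcon (2 ^ k) (by positivity)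
      rw [pow_succ' 2 k]
      push_cast
      linarith
  have h₁ : Tendsto (fun k : ℕ => (k : ℝ) / 2 ^ k) atTop (nhds 0) := by
    simpa using tendsto_pow_const_div_const_pow_of_one_lt 1 (one_lt_two (α := ℝ))
  have h₂ : Tendsto (fun k : ℕ => (1 : ℝ) / 2 ^ k) atTop (nhds 0) := by
    simpa using tendsto_pow_const_div_const_pow_of_one_lt 0 (one_lt_two (α := ℝ))
  have h₃ := (h₂.const_mul (dist p (h • p) + τ)).add (h₁.const_mul c)
  simp only [mul_zero, add_zero] at h₃
  obtain ⟨k, hk⟩ := (h₃.eventually_lt_const (show (0 : ℝ) < τ⁻¹ by positivity)).exists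
  have h₄ := (H (2 ^ k)).trans (key k)
  have h₅ : (dist p (h • p) + τ + c * k) / 2 ^ k < τ⁻¹ := by
    have hk' : (dist p (h • p) + τ) * (1 / 2 ^ k) + c * (k / 2 ^ k) < τ⁻¹ := hk
    convert hk' using 1; ring
  rw [div_lt_iff₀ (by positivity)] at h₅
  push_cast at h₄
  linarith

/-- A loxodromic orbit is a quasi-geodesic: its backward and forward halves have bounded Gromov
product. -/
theorem IsLoxodromic.exists_gromovProduct_le (hX : FourPoint X δ) (hδ : 0 ≤ δ) {h : G}
    (hh : IsLoxodromic X h) (p : X) :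
    ∃ C : ℝ, ∀ m n : ℕ, gromovProduct p ((h ^ m)⁻¹ • p) (h ^ n • p) ≤ C := by
  obtain ⟨N, hN, hlt⟩ := hh.exists_dist_pow_add_lt p (3 * δ)
  set g := h ^ N with hg
  have hgp : ∀ m n : ℕ, gromovProduct p ((g ^ m)⁻¹ • p) (g ^ n • p) ≤
      gromovProduct p (g⁻¹ • p) (g • p) + 2 * δ := by
    intro m n
    have hsmul : ∀ i : ℕ, ((g ^ m)⁻¹ * g ^ (i + 1)) • p = ((g ^ m)⁻¹ * g ^ i) • g • p := by
      intro i; rw [pow_succ, ← mul_assoc, mul_smul _ g]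
    have hturn : ∀ i : ℕ, ((g ^ m)⁻¹ * g ^ i) • p = ((g ^ m)⁻¹ * g ^ (i + 1)) • g⁻¹ • p := by
      intro i; rw [pow_succ, ← mul_assoc, mul_smul _ g, smul_inv_smul]
    have h₁ := hX.gromovProduct_vertex_le hδ (gromovProduct_nonneg p (g⁻¹ • p) (g • p))
      (L := dist p (g • p)) (by
        simp only [gromovProduct, dist_inv_smul_self]
        rw [dist_smul_smul_mul, inv_inv, ← sq, hg, ← pow_mul, mul_comm N]
        linarith) (x := fun i => ((g ^ m)⁻¹ * g ^ i) • p) (n := m + n)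
      (fun i _ => by rw [hsmul, dist_smul])
      (fun i _ => by rw [hturn i, hsmul (i + 1), gromovProduct_smul_smul])
      (i := m) (by omega)
    simpa [pow_add] using h₁
  -- an arbitrary power of `h` is within `N * dist p (h • p)` of a power of `g = h ^ N`
  refine ⟨gromovProduct p (g⁻¹ • p) (g • p) + 2 * δ + 2 * (N * dist p (h • p)), fun m n => ?_⟩
  have hmod : ∀ m : ℕ, dist p (h ^ (m % N) • p) ≤ N * dist p (h • p) := fun m => by
    refine (dist_pow_smul_le h p _).trans ?_
    gcongr
    exact (Nat.mod_lt m hN).le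
  have hm : h ^ m = g ^ (m / N) * h ^ (m % N) := by
    rw [hg, ← pow_mul, ← pow_add, Nat.div_add_mod]
  have hm' : h ^ m = h ^ (m % N) * g ^ (m / N) := by
    rw [hg, ← pow_mul, ← pow_add, Nat.mod_add_div]
  have hn : h ^ n = g ^ (n / N) * h ^ (n % N) := by
    rw [hg, ← pow_mul, ← pow_add, Nat.div_add_mod]
  have h₁ : dist ((h ^ m)⁻¹ • p) ((g ^ (m / N))⁻¹ • p) ≤ N * dist p (h • p) := by
    rw [hm', mul_inv_rev, mul_smul, dist_smul, dist_comm, dist_inv_smul_self]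
    exact hmod m
  have h₂ : dist (h ^ n • p) (g ^ (n / N) • p) ≤ N * dist p (h • p) := by
    rw [hn, mul_smul, dist_smul, dist_comm]
    exact hmod n
  have h₃ := gromovProduct_le_add_dist_left p ((h ^ m)⁻¹ • p) ((g ^ (m / N))⁻¹ • p) (h ^ n • p)
  have h₄ := gromovProduct_le_add_dist_right p ((g ^ (m / N))⁻¹ • p) (h ^ n • p)
    (g ^ (n / N) • p)
  linarith [hgp (m / N) (n / N)]

end Orbit

/-! ### Endpoints of loxodromic elements and independence -/

section Boundary

theorem IsLoxodromic.inv {G X : Type*} [Group G] [MetricSpace X] [MulAction G X] {h : G}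
    (hh : IsLoxodromic X h) : IsLoxodromic X h⁻¹ := by
  obtain ⟨x, τ, hτ, H⟩ := hh
  refine ⟨x, τ, hτ, fun m n => ?_⟩
  have := H (-m) (-n)
  simp only [Int.cast_neg, zpow_neg] at this
  rwa [show -(m : ℝ) - -(n : ℝ) = -((m : ℝ) - n) by ring, abs_neg, ← inv_zpow, ← inv_zpow] at this

variable {G X : Type*} [Group G] [MetricSpace X] [MulAction G X] [IsIsometricSMul G X] {δ : ℝ}

theorem tendsto_gromovProduct_of_base {ι : Type*} {l : Filter ι} {u v : ι → X} (p : X)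
    (h : Tendsto (fun i => gromovProduct p (u i) (v i)) l atTop) (w : X) :
    Tendsto (fun i => gromovProduct w (u i) (v i)) l atTop := by
  refine tendsto_atTop_mono (fun i => ?_) (tendsto_atTop_add_const_right l (-dist p w) h)
  linarith [gromovProduct_le_add_dist_base p w (u i) (v i)]

/-- Along a loxodromic orbit the Gromov product of two points is almost as large as the smaller of
their distances to the base point. -/
theorem IsLoxodromic.exists_min_dist_le (hX : FourPoint X δ) (hδ : 0 ≤ δ) {h : G}
    (hh : IsLoxodromic X h) (p : X) :
    ∃ C : ℝ, ∀ m n : ℕ, min (dist p (h ^ m • p)) (dist p (h ^ n • p)) - C ≤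
      gromovProduct p (h ^ m • p) (h ^ n • p) := by
  obtain ⟨C, hC⟩ := hh.exists_gromovProduct_le hX hδ p
  have key : ∀ m n : ℕ, m ≤ n →
      dist p (h ^ m • p) - C ≤ gromovProduct p (h ^ m • p) (h ^ n • p) := by
    intro m n hmn
    have h₁ := hC m (n - m)
    rw [← gromovProduct_smul_smul (h ^ m), smul_inv_smul, ← mul_smul, ← pow_add,
      Nat.add_sub_cancel' hmn] at h₁
    linarith [gromovProduct_add_swap p (h ^ m • p) (h ^ n • p)]
  refine ⟨C, fun m n => ?_⟩
  rcases le_total m n with hmn | hmn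
  · linarith [key m n hmn, min_le_left (dist p (h ^ m • p)) (dist p (h ^ n • p))]
  · rw [gromovProduct_comm]
    linarith [key n m hmn, min_le_right (dist p (h ^ m • p)) (dist p (h ^ n • p))]

theorem IsLoxodromic.convergesToInfinity (hX : FourPoint X δ) (hδ : 0 ≤ δ) {h : G}
    (hh : IsLoxodromic X h) (p : X) : ConvergesToInfinity fun n : ℕ => h ^ n • p := by
  obtain ⟨C, hC⟩ := hh.exists_min_dist_le hX hδ p
  refine tendsto_gromovProduct_of_base p ?_
  rw [← prod_atTop_atTop_eq]
  refine tendsto_atTop_mono (fun q => hC q.1 q.2) (tendsto_atTop_add_const_right _ (-C) ?_)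
  refine tendsto_atTop.2 fun b => ?_
  have h₁ := tendsto_atTop.1 (hh.tendsto_dist_pow p) b
  filter_upwards [h₁.prod_mk h₁] with q hq
  exact le_min hq.1 hq.2

variable [HyperbolicSpace X]

/-- The boundary point represented by a sequence converging to infinity. -/
def boundaryPoint (u : ℕ → X) (hu : ConvergesToInfinity u) : Boundary X :=
  Quotient.mk (boundarySetoid X) ⟨u, hu⟩

theorem boundaryPoint_eq {u v : ℕ → X} (hu : ConvergesToInfinity u) (hv : ConvergesToInfinity v)
    (h : ∀ w : X, Tendsto (fun n => gromovProduct w (u n) (v n)) atTop atTop) :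
    boundaryPoint u hu = boundaryPoint v hv :=
  Quotient.sound (s := boundarySetoid X) (a := ⟨u, hu⟩) (b := ⟨v, hv⟩) h

/-- The attracting point at infinity of a loxodromic element is fixed by it. -/
theorem boundaryPoint_mem_fixedBy (h : G) (p : X)
    (hc : ConvergesToInfinity fun n : ℕ => h ^ n • p) :
    boundaryPoint (fun n : ℕ => h ^ n • p) hc ∈ MulAction.fixedBy (Boundary X) h := by
  have hc' : ConvergesToInfinity fun n : ℕ => h • h ^ n • p := fun w => by
    simpa only [gromovProduct_smul] using hc (h⁻¹ • w)
  refine boundaryPoint_eq hc' hc fun w => ?_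
  have h₁ : Tendsto (fun n : ℕ => (n + 1, n)) atTop atTop :=
    tendsto_atTop_atTop.2 fun b => ⟨max b.1 b.2, fun n hn =>
      ⟨(le_max_left _ _).trans (hn.trans n.le_succ), (le_max_right _ _).trans hn⟩⟩
  refine ((hc w).comp h₁).congr fun n => ?_
  simp only [Function.comp, pow_succ', mul_smul]

/-- If no boundary point is fixed by both `g` and `h`, then the forward orbits of `g` and `h`
diverge. -/
theorem IsLoxodromic.exists_gromovProduct_le_of_disjoint (hX : FourPoint X δ) (hδ : 0 ≤ δ)
    {g h : G} (hg : IsLoxodromic X g) (hh : IsLoxodromic X h)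
    (hd : Disjoint (MulAction.fixedBy (Boundary X) g) (MulAction.fixedBy (Boundary X) h)) (p : X) :
    ∃ C : ℝ, ∀ m n : ℕ, gromovProduct p (g ^ m • p) (h ^ n • p) ≤ C := by
  by_contra! hcon
  have hu := hg.convergesToInfinity hX hδ p
  have hv := hh.convergesToInfinity hX hδ p
  have huv : boundaryPoint _ hu = boundaryPoint _ hv := by
    refine boundaryPoint_eq hu hv fun w =>
      tendsto_gromovProduct_of_base p (tendsto_atTop.2 fun b => ?_) w
    -- a single pair of points with a large product forces all far points of the two orbits to have
    -- a large product, because each orbit converges to infinity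
    obtain ⟨C, hC⟩ := hg.exists_min_dist_le hX hδ p
    obtain ⟨C', hC'⟩ := hh.exists_min_dist_le hX hδ p
    set B := b + 2 * δ + |C| + |C'| with hB
    obtain ⟨m, l, hml⟩ := hcon B
    filter_upwards [tendsto_atTop.1 (hg.tendsto_dist_pow p) B,
      tendsto_atTop.1 (hh.tendsto_dist_pow p) B] with n hn hn'
    have h₁ := le_min hn (hml.le.trans (gromovProduct_le_dist_left p (g ^ m • p) (h ^ l • p)))
    have h₂ := le_min (hml.le.trans (gromovProduct_le_dist_right p (g ^ m • p) (h ^ l • p))) hn'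
    have h₃ := hC n m
    have h₄ := hC' l n
    have h₅ := hX p (g ^ n • p) (g ^ m • p) (h ^ l • p)
    have h₆ := hX p (g ^ n • p) (h ^ l • p) (h ^ n • p)
    have := le_abs_self C
    have := le_abs_self C'
    have := abs_nonneg C
    have := abs_nonneg C'
    have h₇ : b + 2 * δ + |C'| ≤
        min (gromovProduct p (g ^ n • p) (g ^ m • p)) (gromovProduct p (g ^ m • p) (h ^ l • p)) :=
      le_min (by linarith) (by linarith)
    have h₈ : b + δ ≤
        min (gromovProduct p (g ^ n • p) (h ^ l • p)) (gromovProduct p (h ^ l • p) (h ^ n • p)) :=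
      le_min (by linarith) (by linarith)
    linarith
  refine Set.disjoint_left.1 hd (boundaryPoint_mem_fixedBy g p hu) ?_
  rw [huv]
  exact boundaryPoint_mem_fixedBy h p hv

end Boundary

/-! ### Words in a free group acting on a hyperbolic space -/

/-- The word of `w ^ n` contains `n` copies of the cyclic reduction of `w`, which is not empty. -/
theorem le_norm_pow {α : Type*} [DecidableEq α] {w : FreeGroup α} (hw : w ≠ 1) (n : ℕ) :
    n ≤ (w ^ n).norm := by
  have hr : FreeGroup.reduceCyclically w.toWord ≠ [] := by
    intro h0
    have h := FreeGroup.reduceCyclically.conj_conjugator_reduceCyclically w.toWord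
    rw [h0, List.append_nil] at h
    refine hw ?_
    rw [← FreeGroup.mk_toWord (x := w), ← h, ← FreeGroup.mul_mk, ← FreeGroup.inv_mk,
      mul_inv_cancel]
  rw [FreeGroup.norm, FreeGroup.toWord_pow,
    FreeGroup.reduceCyclically.reduce_flatten_replicate FreeGroup.isReduced_toWord]
  split_ifs with h
  · omega
  · simp only [List.length_append, List.length_flatten, List.map_replicate, List.sum_replicate,
      smul_eq_mul]
    have := Nat.le_mul_of_pos_right n (List.length_pos_iff.2 hr)
    omega

section Words

variable {G X ι : Type*} [Group G] [MetricSpace X] [MulAction G X]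

/-- The group element spelled by a letter `(i, ±)`: a generator `f i` or its inverse. -/
def letter (f : ι → G) (s : ι × Bool) : G :=
  cond s.2 (f s.1) (f s.1)⁻¹

/-- The element spelled by the first `j` letters of the word `l`. -/
def prefixElt (f : ι → G) (l : List (ι × Bool)) (j : ℕ) : G :=
  FreeGroup.lift f (FreeGroup.mk (l.take j))

/-- The generators `f i` displace `p` by at least `L`, and along every reduced word in them the
path through the orbit of `p` turns by a Gromov product of at most `C`. -/
structure IsSpread (f : ι → G) (p : X) (C L : ℝ) : Prop where
  le_dist : ∀ i, L ≤ dist p (f i • p)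
  turn_le : ∀ s t : ι × Bool, (s.1 = t.1 → s.2 = t.2) →
    gromovProduct p ((letter f s)⁻¹ • p) (letter f t • p) ≤ C

theorem prefixElt_zero (f : ι → G) (l : List (ι × Bool)) : prefixElt f l 0 = 1 := by
  simp [prefixElt]

theorem prefixElt_length (f : ι → G) (l : List (ι × Bool)) :
    prefixElt f l l.length = FreeGroup.lift f (FreeGroup.mk l) := by
  simp [prefixElt]

theorem prefixElt_succ (f : ι → G) {l : List (ι × Bool)} {j : ℕ} (hj : j < l.length) :
    prefixElt f l (j + 1) = prefixElt f l j * letter f l[j] := by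
  rw [prefixElt, prefixElt, List.take_succ_eq_append_getElem hj, ← FreeGroup.mul_mk, map_mul,
    FreeGroup.lift_mk (L := [l[j]])]
  simp [letter]

theorem prefixElt_mul_drop (f : ι → G) (l : List (ι × Bool)) (j : ℕ) :
    prefixElt f l j * FreeGroup.lift f (FreeGroup.mk (l.drop j)) =
      FreeGroup.lift f (FreeGroup.mk l) := by
  rw [prefixElt, ← map_mul, FreeGroup.mul_mk, List.take_append_drop]

variable [IsIsometricSMul G X] {δ : ℝ}

theorem dist_letter_smul (f : ι → G) (p : X) (s : ι × Bool) :
    dist p (letter f s • p) = dist p (f s.1 • p) := by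
  rcases s with ⟨i, _ | _⟩
  · exact dist_inv_smul_self _ _
  · rfl

namespace IsSpread

variable {f : ι → G} {p : X} {C L : ℝ}

theorem le_dist_step (hf : IsSpread f p C L) {l : List (ι × Bool)} {i : ℕ} (hi : i < l.length) :
    L ≤ dist (prefixElt f l i • p) (prefixElt f l (i + 1) • p) := by
  rw [prefixElt_succ f hi, mul_smul, dist_smul, dist_letter_smul]
  exact hf.le_dist _

theorem turn_step_le (hf : IsSpread f p C L) {l : List (ι × Bool)} (hl : FreeGroup.IsReduced l)
    {i : ℕ} (hi : i + 1 < l.length) :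
    gromovProduct (prefixElt f l (i + 1) • p) (prefixElt f l i • p)
      (prefixElt f l (i + 2) • p) ≤ C := by
  rw [prefixElt_succ f hi, mul_smul _ (letter f l[i + 1]),
    eq_mul_inv_of_mul_eq (prefixElt_succ f (show i < l.length by omega)).symm, mul_smul _ _⁻¹,
    gromovProduct_smul_smul]
  exact hf.turn_le _ _ (List.isChain_iff_getElem.1 hl i hi)

/-- The vertices of the path of a reduced word stay close to any geodesic joining its ends. -/
theorem gromovProduct_prefix_le (hX : FourPoint X δ) (hδ : 0 ≤ δ) (hC : 0 ≤ C)
    (hL : 2 * C + 3 * δ < L) (hf : IsSpread f p C L) {l : List (ι × Bool)}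
    (hl : FreeGroup.IsReduced l) {i : ℕ} (hi : i ≤ l.length) :
    gromovProduct (prefixElt f l i • p) p (FreeGroup.lift f (FreeGroup.mk l) • p) ≤
      C + 2 * δ := by
  have h := hX.gromovProduct_vertex_le hδ hC hL (x := fun i => prefixElt f l i • p)
    (fun i hi => hf.le_dist_step hi) (fun i hi => hf.turn_step_le hl hi) hi
  simpa only [prefixElt_zero, one_smul, prefixElt_length] using h

theorem length_le_dist (hX : FourPoint X δ) (hδ : 0 ≤ δ) (hC : 0 ≤ C)
    (hL : 2 * C + 3 * δ + 1 ≤ L) (hf : IsSpread f p C L) {l : List (ι × Bool)}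
    (hl : FreeGroup.IsReduced l) :
    l.length ≤ dist p (FreeGroup.lift f (FreeGroup.mk l) • p) := by
  have h := hX.le_dist_start_end hδ hC (show 2 * C + 3 * δ < L by linarith)
    (x := fun i => prefixElt f l i • p)
    (fun i hi => hf.le_dist_step hi) (fun i hi => hf.turn_step_le hl hi)
  simp only [prefixElt_zero, one_smul, prefixElt_length] at h
  refine le_trans (le_mul_of_one_le_right (by positivity) ?_) h
  linarith

theorem norm_le_dist [DecidableEq ι] (hX : FourPoint X δ) (hδ : 0 ≤ δ) (hC : 0 ≤ C)
    (hL : 2 * C + 3 * δ + 1 ≤ L) (hf : IsSpread f p C L) (w : FreeGroup ι) :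
    w.norm ≤ dist p (FreeGroup.lift f w • p) := by
  have := hf.length_le_dist hX hδ hC hL (FreeGroup.isReduced_toWord (x := w))
  rwa [FreeGroup.mk_toWord] at this

theorem le_dist_prefix (hX : FourPoint X δ) (hδ : 0 ≤ δ) (hC : 0 ≤ C)
    (hL : 2 * C + 3 * δ + 1 ≤ L) (hf : IsSpread f p C L) {l : List (ι × Bool)}
    (hl : FreeGroup.IsReduced l) {i : ℕ} (hi : i ≤ l.length) :
    i ≤ dist (prefixElt f l i • p) p := by
  have h := hf.length_le_dist hX hδ hC hL (hl.infix (List.take_prefix i l).isInfix)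
  rwa [List.length_take_of_le hi, dist_comm] at h

theorem le_dist_suffix (hX : FourPoint X δ) (hδ : 0 ≤ δ) (hC : 0 ≤ C)
    (hL : 2 * C + 3 * δ + 1 ≤ L) (hf : IsSpread f p C L) {l : List (ι × Bool)}
    (hl : FreeGroup.IsReduced l) (i : ℕ) :
    ((l.length - i : ℕ) : ℝ) ≤
      dist (prefixElt f l i • p) (FreeGroup.lift f (FreeGroup.mk l) • p) := by
  have h := hf.length_le_dist hX hδ hC hL (hl.infix (List.drop_suffix i l).isInfix)
  rwa [List.length_drop, ← dist_smul (prefixElt f l i), ← mul_smul, prefixElt_mul_drop] at h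

theorem lift_injective [DecidableEq ι] (hX : FourPoint X δ) (hδ : 0 ≤ δ) (hC : 0 ≤ C)
    (hL : 2 * C + 3 * δ + 1 ≤ L) (hf : IsSpread f p C L) :
    Function.Injective (FreeGroup.lift f) := by
  refine (injective_iff_map_eq_one _).2 fun w hw => ?_
  have h := hf.norm_le_dist hX hδ hC hL w
  rw [hw, one_smul, dist_self] at h
  exact FreeGroup.norm_eq_zero.1 (by exact_mod_cast h.antisymm (Nat.cast_nonneg _))

end IsSpread

/-- Displacement growing at least linearly along the positive powers suffices for being loxodromic;
the upper bound holds for every isometry. -/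
theorem isLoxodromic_of_le_dist {g : G} {p : X} (hg : ∀ n : ℕ, (n : ℝ) ≤ dist p (g ^ n • p)) :
    IsLoxodromic X g := by
  refine ⟨p, 1 + dist p (g • p), by linarith [dist_nonneg (x := p) (y := g • p)], fun m n => ?_⟩
  have h₀ : dist (g ^ m • p) (g ^ n • p) = dist p (g ^ (n - m).natAbs • p) := by
    rw [dist_smul_smul_mul, ← zpow_neg, ← zpow_add, neg_add_eq_sub]
    rcases Int.natAbs_eq (n - m) with h | h
    · conv_lhs => rw [h, zpow_natCast]
    · conv_lhs => rw [h, zpow_neg, zpow_natCast, dist_inv_smul_self]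
  have h₁ : |(m : ℝ) - n| = (n - m).natAbs := by
    rw [abs_sub_comm, Nat.cast_natAbs, Int.cast_abs, Int.cast_sub]
  have h₂ := hg (n - m).natAbs
  have h₃ := dist_pow_smul_le g p (n - m).natAbs
  simp only [h₀, h₁]
  set N : ℝ := ((n - m).natAbs : ℝ)
  have hd := dist_nonneg (x := p) (y := g • p)
  have h₄ : (1 + dist p (g • p))⁻¹ * N ≤ N :=
    mul_le_of_le_one_left (Nat.cast_nonneg _) (inv_le_one_of_one_le₀ (by linarith))
  have hN : 0 ≤ N := Nat.cast_nonneg _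
  constructor <;> linarith

theorem IsSpread.isLoxodromic_lift [DecidableEq ι] {f : ι → G} {p : X} {C L : ℝ}
    (hX : FourPoint X δ) (hδ : 0 ≤ δ) (hC : 0 ≤ C) (hL : 2 * C + 3 * δ + 1 ≤ L)
    (hf : IsSpread f p C L) {w : FreeGroup ι} (hw : w ≠ 1) :
    IsLoxodromic X (FreeGroup.lift f w) := by
  refine isLoxodromic_of_le_dist (p := p) fun n => ?_
  rw [← map_pow]
  exact le_trans (by exact_mod_cast le_norm_pow hw n) (hf.norm_le_dist hX hδ hC hL (w ^ n))

end Words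

/-! ### Quasi-isometric embedding of the orbit -/

section QI

variable {G X ι : Type*} [Group G] [MetricSpace X] [MulAction G X] [IsIsometricSMul G X]

theorem dist_list_prod_smul_le {x : X} {B : ℝ} {l : List G}
    (hl : ∀ g ∈ l, dist x (g • x) ≤ B) : dist x (l.prod • x) ≤ l.length * B := by
  induction l with
  | nil => simp
  | cons g l ih =>
    have h₁ := ih fun g' hg' => hl g' (List.mem_cons_of_mem _ hg')
    have h₂ := hl g List.mem_cons_self
    have h₃ := dist_triangle x (g • x) (g • l.prod • x)
    rw [dist_smul] at h₃
    rw [List.prod_cons, mul_smul, List.length_cons]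
    push_cast
    linarith

/-- If word length in the generators `f i` is bounded by displacement at `p`, then the orbit maps
of the subgroup they generate are quasi-isometric embeddings. -/
theorem qiEmbeddedByAction_closure [Finite ι] [DecidableEq ι] {f : ι → G} {p : X}
    (hf : ∀ w : FreeGroup ι, (w.norm : ℝ) ≤ dist p (FreeGroup.lift f w • p)) :
    QIEmbeddedByAction X (Subgroup.closure (Set.range f)) := by
  set H := Subgroup.closure (Set.range f) with hH
  set T : Set H := (↑) ⁻¹' Set.range f with hT
  have hTtop : Subgroup.closure T = ⊤ := Subgroup.closure_closure_coe_preimage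
  refine ⟨T, (Set.finite_range f).preimage Subtype.val_injective.injOn, hTtop, fun x => ?_⟩
  obtain ⟨B, hB⟩ := (Set.finite_range fun i => dist x (f i • x)).bddAbove
  have hB' : ∀ g : H, g ∈ T ∨ g⁻¹ ∈ T → dist x ((g : G) • x) ≤ max B 0 := by
    rintro g (⟨i, hi⟩ | ⟨i, hi⟩)
    · rw [← hi]; exact (hB ⟨i, rfl⟩).trans (le_max_left _ _)
    · rw [← dist_inv_smul_self, ← Subgroup.coe_inv, ← hi]
      exact (hB ⟨i, rfl⟩).trans (le_max_left _ _)
  -- every element of `H` is spelled by a word of length at most its displacement at `p`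
  have hspell : ∀ g : H, ∃ l : List H, (l.length : ℝ) ≤ dist p ((g : G) • p) ∧
      (∀ s ∈ l, s ∈ T ∨ s⁻¹ ∈ T) ∧ l.prod = g := by
    rintro ⟨g, hg⟩
    rw [hH, ← FreeGroup.range_lift_eq_closure] at hg
    obtain ⟨w, rfl⟩ := hg
    have hmem : ∀ s : ι × Bool, letter f s ∈ H := by
      rintro ⟨i, _ | _⟩
      · exact H.inv_mem (Subgroup.subset_closure ⟨i, rfl⟩)
      · exact Subgroup.subset_closure ⟨i, rfl⟩
    refine ⟨w.toWord.map fun s => ⟨letter f s, hmem s⟩, ?_, ?_, ?_⟩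
    · rw [List.length_map]; exact hf w
    · intro s hs
      obtain ⟨⟨i, b⟩, -, rfl⟩ := List.mem_map.1 hs
      cases b
      · exact Or.inr ⟨i, by simp [letter]⟩
      · exact Or.inl ⟨i, rfl⟩
    · refine Subtype.ext ?_
      have h : FreeGroup.lift f w = (w.toWord.map (letter f)).prod := by
        conv_lhs => rw [← FreeGroup.mk_toWord (x := w), FreeGroup.lift_mk]
        rfl
      rw [Subgroup.val_list_prod, List.map_map]
      exact h.symm
  refine ⟨1 + 2 * dist x p + max B 0, by
    linarith [dist_nonneg (x := x) (y := p), le_max_right B 0], fun a b => ?_⟩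
  set g := a⁻¹ * b with hg
  have h₀ : dist ((a : G) • x) ((b : G) • x) = dist x ((g : G) • x) := by
    rw [dist_smul_smul_mul, hg, Subgroup.coe_mul, Subgroup.coe_inv]
  have hlow : (wordLength T g : ℝ) ≤ dist p ((g : G) • p) := by
    obtain ⟨l, hl, hl'⟩ := hspell g
    refine le_trans ?_ hl
    exact Nat.cast_le.2 (Nat.sInf_le ⟨l, rfl, hl'⟩)
  have hup : dist x ((g : G) • x) ≤ wordLength T g * max B 0 := by
    obtain ⟨l, -, hl⟩ := hspell g
    obtain ⟨l', hl', hlT, hlg⟩ := Nat.sInf_mem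
      (s := {n : ℕ | ∃ l : List H, l.length = n ∧ (∀ s ∈ l, s ∈ T ∨ s⁻¹ ∈ T) ∧ l.prod = g})
      ⟨_, l, rfl, hl⟩
    have := dist_list_prod_smul_le (x := x) (l := l'.map ((↑) : H → G)) (B := max B 0) (by
      simpa only [List.forall_mem_map] using fun s hs => hB' s (hlT s hs))
    rwa [← Subgroup.val_list_prod, hlg, List.length_map, hl'] at this
  have h₁ := dist_triangle4 p x ((g : G) • x) ((g : G) • p)
  rw [dist_smul, dist_comm p x] at h₁
  have hd := dist_nonneg (x := x) (y := p)
  have hm := le_max_right B 0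
  have hn : (0 : ℝ) ≤ wordLength T g := Nat.cast_nonneg _
  have h₂ : (1 + 2 * dist x p + max B 0)⁻¹ * wordLength T g ≤ wordLength T g :=
    mul_le_of_le_one_left hn (inv_le_one_of_one_le₀ (by linarith))
  have h₃ := mul_nonneg hd hn
  simp only [h₀]
  constructor
  · linarith
  · linarith

end QI

/-! ### Acylindricity along the orbit -/

section Acylindrical

variable {G X ι : Type*} [Group G] [MetricSpace X] [MulAction G X] [IsIsometricSMul G X] {δ : ℝ}

/-- An isometry moving `a` and `b` by at most `K` moves points near a geodesic from `a` to `b` by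
a bounded amount. -/
theorem FourPoint.dist_smul_le (hX : FourPoint X δ) {a b q : X} {C K : ℝ} {γ : G}
    (hq : gromovProduct q a b ≤ C) (ha : dist a (γ • a) ≤ K) (hb : dist b (γ • b) ≤ K) :
    dist q (γ • q) ≤ 2 * C + K + 2 * δ := by
  have h := hX.dist_add_dist_le a b q (γ • q)
  have h₁ := dist_triangle (γ • q) (γ • b) b
  have h₂ := dist_triangle (γ • q) (γ • a) a
  rw [dist_smul, dist_comm (γ • b)] at h₁
  rw [dist_smul, dist_comm (γ • a)] at h₂
  unfold gromovProduct at hq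
  rcases max_choice (dist q a + dist (γ • q) b) (dist q b + dist (γ • q) a) with h' | h' <;>
    rw [h'] at h <;> linarith

/-- If `q` is near a geodesic from `a` to `b` and far from its ends, then so is `g • q` for every
isometry `g` moving `a` and `b` by at most `ε`, and its closeness does not depend on `ε`. -/
theorem FourPoint.gromovProduct_smul_le (hX : FourPoint X δ) (hδ : 0 ≤ δ) {a b q : X} {C ε : ℝ}
    {g : G} (hq : gromovProduct q a b ≤ C) (ha : dist (g • a) a ≤ ε) (hb : dist (g • b) b ≤ ε)
    (hqa : C + 2 * δ + ε < dist q a) (hqb : C + 2 * δ + ε < dist q b) :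
    gromovProduct (g • q) a b ≤ C + 2 * δ := by
  have key : ∀ c : X, dist (g • c) c ≤ ε → dist q c - ε ≤ gromovProduct (g • q) (g • c) c := by
    intro c hc
    have h := dist_triangle (g • q) c (g • c)
    rw [dist_smul, dist_comm c] at h
    simp only [gromovProduct, dist_smul]
    linarith
  have h₁ := key a ha
  have h₂ := key b hb
  have h₃ : gromovProduct (g • q) a (g • b) ≤ C + δ :=
    hX.le_of_lt ((gromovProduct_smul_smul g q a b).trans_le hq) (by linarith)
  rw [gromovProduct_comm] at h₃ ⊢
  exact (hX.le_of_lt h₃ (by linarith)).trans (by linarith)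

/-- Two points near a geodesic from `a` to `b` and at almost the same distance from `a` are
close. -/
theorem FourPoint.dist_le_of_abs_sub_le (hX : FourPoint X δ) {a b u v : X} {c : ℝ}
    (hu : gromovProduct u a b ≤ c) (hv : gromovProduct v a b ≤ c)
    (huv : |dist u a - dist v a| ≤ 1) : dist u v ≤ 2 * c + 2 * δ + 1 := by
  have h := hX.dist_add_dist_le a b u v
  have := abs_le.1 huv
  unfold gromovProduct at hu hv
  rcases max_choice (dist u a + dist v b) (dist u b + dist v a) with h' | h' <;>
    rw [h'] at h <;> linarith

/-- If only few isometries move both of `q` and `q'` a little, where `q` and `q'` are near a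
geodesic from `a` to `b` and far from its ends, then only few isometries move both `a` and `b` by at
most `ε`. Such an isometry shifts `q` and `q'` along the geodesic by at most `ε`; two isometries
with the same integral parts of the shifts differ by an isometry almost fixing `q` and `q'`. -/
theorem FourPoint.encard_le_of_shift (hX : FourPoint X δ) (hδ : 0 ≤ δ) {a b q q' : X} {C ε : ℝ}
    (hq : gromovProduct q a b ≤ C) (hq' : gromovProduct q' a b ≤ C)
    (hqa : C + 2 * δ + ε < dist q a) (hqb : C + 2 * δ + ε < dist q b)
    (hqa' : C + 2 * δ + ε < dist q' a) (hqb' : C + 2 * δ + ε < dist q' b) {M : ℕ}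
    (hM : {γ : G | dist q (γ • q) ≤ 2 * C + 6 * δ + 1 ∧
      dist q' (γ • q') ≤ 2 * C + 6 * δ + 1}.encard ≤ (M : ℕ∞)) :
    {g : G | dist (g • a) a ≤ ε ∧ dist (g • b) b ≤ ε}.encard ≤
      (((⌊2 * ε⌋₊ + 1) * (⌊2 * ε⌋₊ + 1) * M : ℕ) : ℕ∞) := by
  set A := {g : G | dist (g • a) a ≤ ε ∧ dist (g • b) b ≤ ε}
  let shift (r : X) (g : G) : ℕ := ⌊dist (g • r) a - dist r a + ε⌋₊
  have hshift : ∀ r : X, ∀ g ∈ A, 0 ≤ dist (g • r) a - dist r a + ε ∧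
      dist (g • r) a - dist r a + ε ≤ 2 * ε := by
    intro r g hg
    have h₁ := dist_triangle (g • r) (g • a) a
    have h₂ := dist_triangle (g • r) a (g • a)
    rw [dist_smul, dist_comm a] at h₂
    rw [dist_smul] at h₁
    constructor <;> linarith [hg.1]
  have hclose : ∀ r : X, gromovProduct r a b ≤ C → C + 2 * δ + ε < dist r a →
      C + 2 * δ + ε < dist r b → ∀ g₁ ∈ A, ∀ g₂ ∈ A, shift r g₁ = shift r g₂ →
      dist r ((g₁⁻¹ * g₂) • r) ≤ 2 * C + 6 * δ + 1 := by
    intro r hr hra hrb g₁ hg₁ g₂ hg₂ h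
    have h₁ := (Nat.floor_eq_iff (hshift r g₁ hg₁).1).1 h
    have h₂ := (Nat.floor_eq_iff (hshift r g₂ hg₂).1).1 (Eq.refl (shift r g₂))
    have h₃ := hX.dist_le_of_abs_sub_le (hX.gromovProduct_smul_le hδ hr hg₁.1 hg₁.2 hra hrb)
      (hX.gromovProduct_smul_le hδ hr hg₂.1 hg₂.2 hra hrb)
      (abs_le.2 ⟨by linarith [h₁.1, h₂.2], by linarith [h₁.2, h₂.1]⟩)
    rw [dist_smul_smul_mul] at h₃
    linarith
  set T := Finset.range (⌊2 * ε⌋₊ + 1) ×ˢ Finset.range (⌊2 * ε⌋₊ + 1) with hT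
  have hcover : A ⊆ ⋃ c ∈ T, {g | g ∈ A ∧ (shift q g, shift q' g) = c} := by
    intro g hg
    refine Set.mem_biUnion (x := (shift q g, shift q' g)) ?_ ⟨hg, rfl⟩
    simp only [hT, SetLike.mem_coe, Finset.mem_product, Finset.mem_range, Order.lt_add_one_iff]
    exact ⟨Nat.floor_mono (hshift q g hg).2, Nat.floor_mono (hshift q' g hg).2⟩
  have hfib : ∀ c ∈ T, {g | g ∈ A ∧ (shift q g, shift q' g) = c}.encard ≤ (M : ℕ∞) := by
    rintro c -
    rcases Set.eq_empty_or_nonempty {g | g ∈ A ∧ (shift q g, shift q' g) = c} with h | ⟨g₁, hg₁⟩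
    · rw [h]; simp
    · refine le_trans ?_ hM
      refine Set.encard_le_encard_of_injOn (f := fun g => g₁⁻¹ * g) (fun g hg => ?_)
        (mul_right_injective g₁⁻¹).injOn
      have h := Prod.ext_iff.1 (hg₁.2.trans hg.2.symm)
      exact ⟨hclose q hq hqa hqb g₁ hg₁.1 g hg.1 h.1, hclose q' hq' hqa' hqb' g₁ hg₁.1 g hg.1 h.2⟩
  calc A.encard ≤ (⋃ c ∈ T, {g | g ∈ A ∧ (shift q g, shift q' g) = c}).encard :=
        Set.encard_le_encard hcover
    _ ≤ ∑ c ∈ T, {g | g ∈ A ∧ (shift q g, shift q' g) = c}.encard :=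
        T.set_encard_biUnion_le _
    _ ≤ ∑ _c ∈ T, (M : ℕ∞) := Finset.sum_le_sum hfib
    _ = _ := by
        rw [Finset.sum_const, hT, Finset.card_product, Finset.card_range, nsmul_eq_mul]
        push_cast
        rfl

/-- Conjugation by `u` carries the isometries almost fixing `u • p` and `u • q` to those almost
fixing `p` and `q`. -/
theorem encard_almost_fixing_smul (u : G) (p q : X) (K : ℝ) :
    {γ : G | dist (u • p) (γ • u • p) ≤ K ∧ dist (u • q) (γ • u • q) ≤ K}.encard ≤
      {γ : G | dist p (γ • p) ≤ K ∧ dist q (γ • q) ≤ K}.encard := by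
  refine Set.encard_le_encard_of_injOn (f := fun γ => u⁻¹ * γ * u) (fun γ hγ => ?_)
    (fun γ _ γ' _ h => by simpa using h)
  have h : ∀ r : X, dist r ((u⁻¹ * γ * u) • r) = dist (u • r) (γ • u • r) := fun r => by
    rw [mul_smul, mul_smul, ← dist_smul u, smul_inv_smul]
  exact ⟨(h p).trans_le hγ.1, (h q).trans_le hγ.2⟩

/-- If the generators are spread out at `p` and only finitely many isometries almost fix `p` and
`f i • p`, then the action is acylindrical along the orbit of `p` under the group they generate. -/
theorem IsSpread.acylindricalAlong [Finite ι] (hX : FourPoint X δ) (hδ : 0 ≤ δ) {f : ι → G} {p : X}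
    {C L : ℝ} (hC : 0 ≤ C) (hL : 2 * C + 3 * δ + 1 ≤ L) (hf : IsSpread f p C L)
    (hfin : ∀ i, {γ : G | dist p (γ • p) ≤ 2 * C + 10 * δ + 1 ∧
      dist (f i • p) (γ • f i • p) ≤ 2 * C + 10 * δ + 1}.Finite) :
    AcylindricalAlong G
      (Set.range fun a : Subgroup.closure (Set.range f) => (a : G) • p) := by
  classical
  set K := 2 * C + 10 * δ + 1 with hK
  obtain ⟨M, hM⟩ := (Set.finite_range fun i =>
    {γ : G | dist p (γ • p) ≤ K ∧ dist (f i • p) (γ • f i • p) ≤ K}.ncard).bddAbove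
  have hletter : ∀ s : ι × Bool,
      {γ : G | dist p (γ • p) ≤ K ∧ dist (letter f s • p) (γ • letter f s • p) ≤ K}.encard ≤
        (M : ℕ∞) := by
    have hpos : ∀ i, {γ : G | dist p (γ • p) ≤ K ∧
        dist (f i • p) (γ • f i • p) ≤ K}.encard ≤ (M : ℕ∞) := fun i => by
      rw [← (hfin i).cast_ncard_eq]
      exact_mod_cast hM ⟨i, rfl⟩
    rintro ⟨i, _ | _⟩
    -- translating by `f i` turns the pair for `(f i)⁻¹` into the pair for `f i`, reversed
    · have h := encard_almost_fixing_smul (f i)⁻¹ p (f i • p) K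
      rw [inv_smul_smul] at h
      refine le_trans (le_of_eq ?_) (h.trans (hpos i))
      congr 1
      ext γ
      exact and_comm
    · exact hpos i
  obtain ⟨B, hB⟩ := (Set.finite_range fun i => dist p (f i • p)).bddAbove
  have hB' : ∀ s : ι × Bool, dist p (letter f s • p) ≤ max B 1 := fun s =>
    (dist_letter_smul f p s).trans_le ((hB ⟨s.1, rfl⟩).trans (le_max_left _ _))
  intro ε hε
  -- the vertices number `J` and `J + 1` of a path of at least `2 * J + 1` steps are far from its
  -- ends
  obtain ⟨J, hJ⟩ := exists_nat_gt (C + 2 * δ + 2 * δ + ε)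
  refine ⟨(2 * J + 1 : ℕ) * max B 1, by positivity,
    (⌊2 * ε⌋₊ + 1) * (⌊2 * ε⌋₊ + 1) * (M + 1), by positivity, ?_⟩
  rintro _ ⟨⟨a, ha⟩, rfl⟩ _ ⟨⟨b, hb⟩, rfl⟩ hab
  dsimp only at hab ⊢
  have hmem := (Subgroup.closure (Set.range f)).mul_mem (inv_mem ha) hb
  rw [← FreeGroup.range_lift_eq_closure] at hmem
  obtain ⟨w, hw⟩ := hmem
  obtain rfl : b = a * FreeGroup.lift f w := by rw [hw, mul_inv_cancel_left]
  set l := w.toWord with hl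
  have hlw : FreeGroup.mk l = w := FreeGroup.mk_toWord
  have hred : FreeGroup.IsReduced l := FreeGroup.isReduced_toWord
  have hlen : 2 * J + 1 ≤ l.length := by
    have h := dist_list_prod_smul_le (x := p) (l := l.map (letter f)) (B := max B 1) (by
      simpa only [List.forall_mem_map] using fun s _ => hB' s)
    rw [dist_smul_smul_mul, inv_mul_cancel_left, ← hlw, FreeGroup.lift_mk] at hab
    have h' := le_of_mul_le_mul_right (hab.trans h) (lt_max_of_lt_right one_pos)
    rw [List.length_map] at h'
    exact_mod_cast h'
  have hqL : ∀ i ≤ l.length, gromovProduct ((a * prefixElt f l i) • p) (a • p)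
      ((a * FreeGroup.lift f w) • p) ≤ C + 2 * δ := fun i hi => by
    rw [mul_smul, mul_smul, gromovProduct_smul_smul, ← hlw]
    exact hf.gromovProduct_prefix_le hX hδ hC (by linarith) hred hi
  have hqa : ∀ i, J ≤ i → i ≤ l.length →
      C + 2 * δ + 2 * δ + ε < dist ((a * prefixElt f l i) • p) (a • p) := fun i hi hi' => by
    rw [mul_smul, dist_smul]
    exact hJ.trans_le (le_trans (Nat.cast_le.2 hi) (hf.le_dist_prefix hX hδ hC hL hred hi'))
  have hqb : ∀ i, J + i ≤ l.length → C + 2 * δ + 2 * δ + ε <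
      dist ((a * prefixElt f l i) • p) ((a * FreeGroup.lift f w) • p) := fun i hi => by
    rw [mul_smul, mul_smul, dist_smul, ← hlw]
    exact hJ.trans_le (le_trans (Nat.cast_le.2 (by omega)) (hf.le_dist_suffix hX hδ hC hL hred i))
  refine (hX.encard_le_of_shift hδ (hqL J (by omega)) (hqL (J + 1) (by omega))
    (hqa J le_rfl (by omega)) (hqb J (by omega)) (hqa (J + 1) (by omega) (by omega))
    (hqb (J + 1) (by omega)) (M := M) ?_).trans ?_
  · rw [show 2 * (C + 2 * δ) + 6 * δ + 1 = K by rw [hK]; ring,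
      prefixElt_succ f (show J < l.length by omega), ← mul_assoc, mul_smul _ (letter f l[J])]
    exact (encard_almost_fixing_smul _ p _ K).trans (hletter _)
  · exact Nat.cast_le.2 (Nat.mul_le_mul_left _ M.le_succ)

/-- Loxodromic elements of a subgroup are WPD if the action is acylindrical along an orbit of the
subgroup. -/
theorem AcylindricalAlong.isLoxodromicWPD {H : Subgroup G} {p : X}
    (hH : AcylindricalAlong G (Set.range fun a : H => (a : G) • p)) {g : G} (hg : g ∈ H)
    (hlox : IsLoxodromic X g) : IsLoxodromicWPD X g := by
  refine ⟨hlox, fun x ε hε => ?_⟩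
  obtain ⟨R, -, M, -, hM⟩ := hH (ε + 2 * dist p x) (by positivity)
  obtain ⟨N, hN, hN'⟩ := ((tendsto_atTop.1 (hlox.tendsto_dist_pow p) R).and
    (eventually_gt_atTop 0)).exists
  refine ⟨N, hN', Set.Finite.subset (Set.finite_of_encard_le_coe
    (hM p ⟨1, one_smul G p⟩ (g ^ N • p) ⟨⟨g ^ N, H.pow_mem hg N⟩, rfl⟩ hN)) ?_⟩
  have key : ∀ (γ : G) (y z : X), dist z (γ • z) ≤ ε → dist (γ • y) y ≤ ε + 2 * dist y z := by
    intro γ y z h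
    have := dist_triangle4 y z (γ • z) (γ • y)
    rw [dist_smul, dist_comm z y] at this
    rw [dist_comm]
    linarith
  rintro γ ⟨h₁, h₂⟩
  refine ⟨key γ _ _ h₁, ?_⟩
  simpa only [dist_smul] using key γ (g ^ N • p) _ h₂

end Acylindrical

/-! ### High powers of independent loxodromic WPD elements -/

section Powers

theorem isLoxodromic_letter {G X ι : Type*} [Group G] [MetricSpace X] [MulAction G X]
    {h : ι → G} (hh : ∀ i, IsLoxodromic X (h i)) (s : ι × Bool) :
    IsLoxodromic X (letter h s) := by
  rcases s with ⟨i, _ | _⟩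
  · exact (hh i).inv
  · exact hh i

variable {G X ι : Type*} [Group G] [MetricSpace X] [MulAction G X] [IsIsometricSMul G X] {δ : ℝ}

/-- For a loxodromic WPD element `h`, the WPD condition at one power gives the finiteness for all
larger powers: `h ^ N • p` lies near a geodesic from `p` to `h ^ d • p`. -/
theorem IsLoxodromicWPD.exists_forall_finite (hX : FourPoint X δ) (hδ : 0 ≤ δ) {h : G}
    (hh : IsLoxodromicWPD X h) (p : X) {K : ℝ} (hK : 0 ≤ K) :
    ∃ N : ℕ, ∀ d, N ≤ d →
      {γ : G | dist p (γ • p) ≤ K ∧ dist (h ^ d • p) (γ • h ^ d • p) ≤ K}.Finite := by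
  obtain ⟨C, hC⟩ := hh.1.exists_gromovProduct_le hX hδ p
  have hC0 : 0 ≤ C := (gromovProduct_nonneg _ _ _).trans (hC 0 0)
  obtain ⟨N, -, hN⟩ := hh.2 p (2 * C + K + 2 * δ) (by positivity)
  refine ⟨N, fun d hd => hN.subset ?_⟩
  rintro γ ⟨h₁, h₂⟩
  refine ⟨by linarith, hX.dist_smul_le (C := C) ?_ h₁ h₂⟩
  have h₃ := hC N (d - N)
  rwa [← gromovProduct_smul_smul (h ^ N), smul_inv_smul, ← mul_smul, ← pow_add,
    Nat.add_sub_cancel' hd] at h₃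

theorem letter_pow (h : ι → G) (d : ι → ℕ) (s : ι × Bool) :
    letter (fun i => h i ^ d i) s = letter h s ^ d s.1 := by
  rcases s with ⟨i, _ | _⟩
  · exact (inv_pow _ _).symm
  · rfl

variable [HyperbolicSpace X]

/-- For independent loxodromic elements, one bound on the turning holds for all exponents. -/
theorem Independent.exists_turn_le [Finite ι] (hX : FourPoint X δ) (hδ : 0 ≤ δ) {h : ι → G}
    (hh : ∀ i, IsLoxodromic X (h i)) (hind : Independent X h) (p : X) :
    ∃ C : ℝ, 0 ≤ C ∧ ∀ (d : ι → ℕ) (s t : ι × Bool), (s.1 = t.1 → s.2 = t.2) →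
      gromovProduct p ((letter (fun i => h i ^ d i) s)⁻¹ • p)
        (letter (fun i => h i ^ d i) t • p) ≤ C := by
  have hfix : ∀ s : ι × Bool, MulAction.fixedBy (Boundary X) (letter h s) =
      MulAction.fixedBy (Boundary X) (h s.1) := by
    rintro ⟨i, _ | _⟩
    · exact MulAction.fixedBy_inv (Boundary X) (h i)
    · rfl
  have hpair : ∀ q : (ι × Bool) × (ι × Bool), ∃ C : ℝ, (q.1.1 = q.2.1 → q.1.2 = q.2.2) →
      ∀ m n : ℕ, gromovProduct p ((letter h q.1 ^ m)⁻¹ • p) (letter h q.2 ^ n • p) ≤ C := by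
    rintro ⟨s, t⟩
    by_cases hst : s.1 = t.1
    · obtain ⟨C, hC⟩ := (isLoxodromic_letter hh s).exists_gromovProduct_le hX hδ p
      refine ⟨C, fun h' => ?_⟩
      obtain rfl : s = t := Prod.ext hst (h' hst)
      exact hC
    · obtain ⟨C, hC⟩ := (isLoxodromic_letter hh s).inv.exists_gromovProduct_le_of_disjoint hX hδ
        (isLoxodromic_letter hh t)
        (by rw [MulAction.fixedBy_inv (Boundary X), hfix, hfix]; exact hind _ _ hst) p
      exact ⟨C, fun _ m n => by rw [← inv_pow]; exact hC m n⟩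
  choose C hC using hpair
  obtain ⟨B, hB⟩ := (Set.finite_range C).bddAbove
  refine ⟨max B 0, le_max_right _ _, fun d s t hst => ?_⟩
  rw [letter_pow, letter_pow]
  exact (hC (s, t) hst _ _).trans ((hB ⟨_, rfl⟩).trans (le_max_left _ _))

end Powers

end AQI

theorem corollary4p5 {G X : Type*} [Group G] [MetricSpace X] [AQI.HyperbolicSpace X]
    [MulAction G X] [IsIsometricSMul G X] (k : ℕ) (hk : 1 ≤ k) (h : Fin k → G)
    (hWPD : ∀ i, AQI.IsLoxodromicWPD X (h i)) (hind : AQI.Independent X h) :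
    ∃ D : ℕ, 1 ≤ D ∧ ∀ d : Fin k → ℕ, (∀ i, D ≤ d i) →
      AQI.IsAQITriple G X (Subgroup.closure (Set.range fun i => h i ^ d i)) ∧
      ∀ g ∈ Subgroup.closure (Set.range fun i => h i ^ d i), g ≠ 1 →
        AQI.IsLoxodromicWPD X g := by
  obtain ⟨δ, hδ, hX⟩ := AQI.HyperbolicSpace.exists_delta (X := X)
  replace hX : AQI.FourPoint X δ := hX
  obtain ⟨p, -⟩ := (hWPD ⟨0, hk⟩).1
  obtain ⟨C, hC, hturn⟩ := hind.exists_turn_le hX hδ (fun i => (hWPD i).1) p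
  choose N hN using fun i =>
    (hWPD i).exists_forall_finite hX hδ p (K := 2 * C + 10 * δ + 1) (by positivity)
  choose N' hN' using fun i => eventually_atTop.1
    (tendsto_atTop.1 ((hWPD i).1.tendsto_dist_pow p) (2 * C + 3 * δ + 1))
  obtain ⟨D, hD⟩ := (Set.finite_range fun i => N i + N' i).bddAbove
  refine ⟨D + 1, by omega, fun d hd => ?_⟩
  have hNd : ∀ i, N i + N' i ≤ d i := fun i =>
    (hD ⟨i, rfl⟩).trans (Nat.le_of_succ_le (hd i))
  have hf : AQI.IsSpread (fun i => h i ^ d i) p C (2 * C + 3 * δ + 1) :=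
    ⟨fun i => hN' i _ (by have := hNd i; omega), hturn d⟩
  have hacyl := hf.acylindricalAlong hX hδ hC le_rfl
    (fun i => hN i _ (by have := hNd i; omega))
  refine ⟨⟨?_, ?_, ⟨p, hacyl⟩, ?_⟩, fun g hg hg1 => hacyl.isLoxodromicWPD hg ?_⟩
  · exact (Subgroup.fg_iff _).2 ⟨_, rfl, Set.finite_range _⟩
  · have : Nonempty (Fin k) := ⟨⟨0, hk⟩⟩
    rw [← FreeGroup.range_lift_eq_closure]
    exact Infinite.of_injective _ (MonoidHom.rangeRestrict_injective_iff.2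
      (hf.lift_injective hX hδ hC le_rfl))
  · exact AQI.qiEmbeddedByAction_closure (hf.norm_le_dist hX hδ hC le_rfl)
  · rw [← FreeGroup.range_lift_eq_closure] at hg
    obtain ⟨w, rfl⟩ := hg
    exact hf.isLoxodromic_lift hX hδ hC le_rfl (by rintro rfl; exact hg1 (map_one _))
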